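/- Let $A$ be a (not necessarily unital) C*-algebra and let $E$ be a Hilbert C*-module over $A$, i.e. a right $A$-module with an $A$-valued inner product $\langle\cdot,\cdot\rangle$ (linear in the second variable) such that the norm $\|\xi\|=\|\langle \xi,\xi\rangle\|^{1/2}$ makes $E$ a Banach space. Let $\mathcal L(E)$ be the algebra of adjointable operators on $E$, i.e. the linear operators $S$ on $E$ such that for every $y\in E$ there is $y'\in E$ with $\langle Sx,y\rangle=\langle x,y'\rangle$ for all $x\in E$ (such operators are automatically bounded), and let $\operatorname{End}_A(E)$ be the algebra of all bounded linear operators $S$ on $E$ with $S(xa)=S(x)a$ for all $x\in E$, $a\in A$. For a unital algebra $\mathfrak A$ of bounded operators on a Banach space $X$, let $\operatorname{Lat}\mathfrak A$ be the set of closed subspaces of $X$ invariant under every operator in $\mathfrak A$; for a set $\mathfrak L$ of closed subspaces, let $\operatorname{Alg}\mathfrak L$ be the algebra of bounded operators on $X$ leaving every member of $\mathfrak L$ invariant; $\mathfrak A$ is called reflexive if $\mathfrak A=\operatorname{Alg}\operatorname{Lat}\mathfrak A$. Then $$\operatorname{Alg}\operatorname{Lat}\mathcal L(E)=\operatorname{End}_A(E).$$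 In particular, $\operatorname{End}_A(E)$ is a reflexive algebra of operators on $E$, and $\mathcal L(E)$ is reflexive if and only if $\mathcal L(E)=\operatorname{End}_A(E)$. -/

import Mathlib

open scoped RightActions

/-! ### Invariant subspaces and reflexivity for operator algebras on a Banach space -/

section Reflexivity

variable {X : Type*} [NormedAddCommGroup X] [NormedSpace ℂ X]

/-- `Lat 𝔄`: the closed subspaces of `X` that are left invariant by every operator in the unital
operator algebra `𝔄`. -/
def lat (𝔄 : Subalgebra ℂ (X →L[ℂ] X)) : Set (Submodule ℂ X) :=
  {M | IsClosed (M : Set X) ∧ ∀ T ∈ 𝔄, ∀ m ∈ M, T m ∈ M}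

/-- `Alg 𝔏`: the algebra of all bounded operators on `X` that leave invariant every member
of `𝔏`. -/
def alg (𝔏 : Set (Submodule ℂ X)) : Subalgebra ℂ (X →L[ℂ] X) where
  carrier := {T | ∀ M ∈ 𝔏, ∀ m ∈ M, T m ∈ M}
  mul_mem' hS hT M hM m hm := hS M hM _ (hT M hM m hm)
  add_mem' hS hT M hM m hm := M.add_mem (hS M hM m hm) (hT M hM m hm)
  algebraMap_mem' c M _ m hm := by
    simpa [Algebra.algebraMap_eq_smul_one] using M.smul_mem c hm

/-- The reflexive cover `Alg Lat 𝔄` of an operator algebra `𝔄`. -/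
def reflexiveCover (𝔄 : Subalgebra ℂ (X →L[ℂ] X)) : Subalgebra ℂ (X →L[ℂ] X) :=
  alg (lat 𝔄)

/-- An operator algebra is reflexive if it is equal to its reflexive cover. -/
def IsReflexive (𝔄 : Subalgebra ℂ (X →L[ℂ] X)) : Prop :=
  𝔄 = reflexiveCover 𝔄

end Reflexivity

/-! ### Operators on a Hilbert C⋆-module

Mathlib's `CStarModule B E` is written for a left action, `⟪x, b • y⟫ = b * ⟪x, y⟫`. A right Hilbert
C⋆-module over `A` is a `CStarModule Aᵐᵒᵖ E`: with `x <• a = MulOpposite.op a • x` the right action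
and `MulOpposite.unop (inner Aᵐᵒᵖ x y)` the `A`-valued inner product, the axiom reads
`⟪x, y <• a⟫ = ⟪x, y⟫ * a` (see `HilbertModule.ip_smul_right`). The remaining laws of a right
module action follow from the axioms of the inner product. -/

namespace HilbertModule

section

variable (A : Type*) [NonUnitalCStarAlgebra A] [PartialOrder A]
  {E : Type*} [NormedAddCommGroup E] [NormedSpace ℂ E] [SMul Aᵐᵒᵖ E] [CStarModule Aᵐᵒᵖ E]

/-- The `A`-valued inner product of a right Hilbert C⋆-module over `A`, linear in the second
variable. -/
def ip (x y : E) : A := MulOpposite.unop (inner Aᵐᵒᵖ x y)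

theorem ip_smul_right (x y : E) (a : A) : ip A x (y <• a) = ip A x y * a := by
  simp [ip]

theorem ip_add_right (x y z : E) : ip A x (y + z) = ip A x y + ip A x z := by
  simp [ip]

theorem ip_add_left (x y z : E) : ip A (x + y) z = ip A x z + ip A y z := by
  simp [ip]

theorem ip_smul_right_complex (c : ℂ) (x y : E) : ip A x (c • y) = c • ip A x y := by
  simp [ip]

theorem ip_smul_left_complex (c : ℂ) (x y : E) : ip A (c • x) y = star c • ip A x y := by
  simp [ip]

/-- Vectors of a Hilbert C⋆-module are separated by their inner products. -/
theorem ext_ip {y z : E} (h : ∀ x : E, ip A x y = ip A x z) : y = z := by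
  have h1 : inner Aᵐᵒᵖ (y - z) (y - z) = 0 := by
    rw [CStarModule.inner_sub_right, sub_eq_zero]
    exact MulOpposite.unop_injective (h (y - z))
  exact sub_eq_zero.mp (CStarModule.inner_self.mp h1)

theorem add_rsmul (x y : E) (a : A) : (x + y) <• a = x <• a + y <• a :=
  ext_ip A fun w => by simp only [ip_smul_right, ip_add_right, add_mul]

theorem smul_rsmul (c : ℂ) (x : E) (a : A) : (c • x) <• a = c • (x <• a) :=
  ext_ip A fun w => by simp only [ip_smul_right, ip_smul_right_complex, smul_mul_assoc]

/-- An operator `S` on `E` is adjointable if for every `y` there is a `y'` such that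
`⟪S x, y⟫ = ⟪x, y'⟫` for all `x`. -/
def IsAdjointable (S : E → E) : Prop :=
  ∀ y : E, ∃ y' : E, ∀ x : E, ip A (S x) y = ip A x y'

variable (E)

/-- `ℒ(E)`: the algebra of all adjointable operators on `E`. Boundedness is automatic for
adjointable linear operators on a Hilbert C⋆-module, see `IsAdjointable.continuous`. -/
def adjointableOperators : Subalgebra ℂ (E →L[ℂ] E) where
  carrier := {S | IsAdjointable A S}
  mul_mem' {S T} hS hT y := by
    obtain ⟨y', hy'⟩ := hS y
    obtain ⟨y'', hy''⟩ := hT y'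
    exact ⟨y'', fun x => (hy' (T x)).trans (hy'' x)⟩
  add_mem' {S T} hS hT y := by
    obtain ⟨y', hy'⟩ := hS y
    obtain ⟨y'', hy''⟩ := hT y
    refine ⟨y' + y'', fun x => ?_⟩
    rw [add_apply, ip_add_left, ip_add_right, hy', hy'']
  algebraMap_mem' c y := by
    refine ⟨star c • y, fun x => ?_⟩
    rw [ip_smul_right_complex, ← ip_smul_left_complex]
    simp [Algebra.algebraMap_eq_smul_one]

/-- `End_A(E)`: the algebra of all bounded `A`-module operators on `E`. -/
def boundedModuleMaps : Subalgebra ℂ (E →L[ℂ] E) where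
  carrier := {S | ∀ (x : E) (a : A), S (x <• a) = S x <• a}
  mul_mem' {S T} hS hT x a := by
    rw [mul_apply_eq_comp, hT, hS, mul_apply_eq_comp]
  add_mem' {S T} hS hT x a := by
    rw [add_apply, hS, hT, add_apply, add_rsmul]
  algebraMap_mem' c x a := by
    simp [Algebra.algebraMap_eq_smul_one, smul_rsmul]

end

/-- An adjointable linear operator on a Hilbert C⋆-module is automatically bounded. -/
theorem IsAdjointable.continuous {A : Type*} [NonUnitalCStarAlgebra A] [PartialOrder A]
    [StarOrderedRing A] {E : Type*} [NormedAddCommGroup E] [NormedSpace ℂ E] [CompleteSpace E]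
    [SMul Aᵐᵒᵖ E] [CStarModule Aᵐᵒᵖ E] {S : E →ₗ[ℂ] E} (hS : IsAdjointable A S) :
    Continuous S := by
  have hc : ∀ {u v : ℕ → E} {x y : E}, Filter.Tendsto u Filter.atTop (nhds x) →
      Filter.Tendsto v Filter.atTop (nhds y) →
      Filter.Tendsto (fun n => inner Aᵐᵒᵖ (u n) (v n)) Filter.atTop (nhds (inner Aᵐᵒᵖ x y)) :=
    fun hu hv => (CStarModule.continuous_inner (A := Aᵐᵒᵖ)).continuousAt.tendsto.comp
      (hu.prodMk_nhds hv)
  refine LinearMap.continuous_of_seq_closed_graph S fun u x y hu hSu => ?_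
  have h1 : ∀ w : E, inner Aᵐᵒᵖ y w = inner Aᵐᵒᵖ (S x) w := by
    intro w
    obtain ⟨w', hw'⟩ := hS w
    have hw : ∀ z, inner Aᵐᵒᵖ (S z) w = inner Aᵐᵒᵖ z w' := fun z =>
      MulOpposite.unop_injective (hw' z)
    have h2 := hc hSu (tendsto_const_nhds (x := w))
    simp only [Function.comp_apply, hw] at h2
    rw [hw]
    exact tendsto_nhds_unique h2 (hc hu tendsto_const_nhds)
  refine ext_ip A fun w => ?_
  have h3 := congrArg star (h1 w)
  rw [CStarModule.star_inner, CStarModule.star_inner] at h3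
  exact congrArg MulOpposite.unop h3

end HilbertModule

/-! Let `T` be a bounded module map and `M` a closed subspace invariant under the adjointable
operators. Each `m ∈ M` is a limit of vectors `m⟨y, m⟩`, so `T m` is a limit of vectors `(T m)⟨y,
m⟩`, which are images of `m` under rank-one adjointable operators. Hence `T m ∈ M`
(`boundedModuleMaps_le_alg_lat`).

Conversely, for each `b` the vectors with `x b = 0`, and those with `x b = x`, form a member of the
lattice, so every `T` in the reflexive cover is local. Cut `a ≥ 0` into ramps: locality confines the
commutator of `T` with a ramp to neighbouring slices of the spectrum, and slices far apart do not
interact. The commutator with `a` is therefore bounded independently of `a`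
(`IsLocal.norm_commutator_le`). Replacing `a` by `n a` forces it to vanish, and positive elements
span `A`. -/

section ReflexiveCover

variable {X : Type*} [NormedAddCommGroup X] [NormedSpace ℂ X]

theorem eqLocus_mem_lat {P Q : X →L[ℂ] X} {𝔄 : Subalgebra ℂ (X →L[ℂ] X)}
    (hP : ∀ S ∈ 𝔄, ∀ x, S (P x) = P (S x)) (hQ : ∀ S ∈ 𝔄, ∀ x, S (Q x) = Q (S x)) :
    LinearMap.eqLocus (P : X →ₗ[ℂ] X) Q ∈ lat 𝔄 := by
  refine ⟨isClosed_eq P.continuous Q.continuous, fun S hS x hx => ?_⟩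
  have hx : P x = Q x := hx
  change P (S x) = Q (S x)
  rw [← hP S hS, ← hQ S hS, hx]

theorem isReflexive_alg_lat (𝔄 : Subalgebra ℂ (X →L[ℂ] X)) : IsReflexive (alg (lat 𝔄)) :=
  le_antisymm (fun T hT _ hM m hm => hM.2 T hT m hm)
    fun _ hT M hM m hm => hT M ⟨hM.1, fun _ hS => hS M hM⟩ m hm

end ReflexiveCover

namespace HilbertModule

/-! ### Right multiplication as a bounded bilinear map -/

section RightMultiplication

variable {A : Type*} [NonUnitalCStarAlgebra A] [PartialOrder A]
  {E : Type*} [NormedAddCommGroup E] [NormedSpace ℂ E] [SMul Aᵐᵒᵖ E] [CStarModule Aᵐᵒᵖ E]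

theorem star_ip (x y : E) : star (ip A x y) = ip A y x :=
  congrArg MulOpposite.unop (CStarModule.star_inner (A := Aᵐᵒᵖ) x y)

theorem ip_smul_left (x y : E) (a : A) : ip A (x <• a) y = star a * ip A x y := by
  rw [← star_ip, ip_smul_right, star_mul, star_ip]

theorem norm_sq_eq_norm_ip (x : E) : ‖x‖ ^ 2 = ‖ip A x x‖ :=
  CStarModule.norm_sq_eq Aᵐᵒᵖ

theorem ip_self_nonneg (x : E) : 0 ≤ ip A x x :=
  MulOpposite.unop_nonneg.mpr (CStarModule.inner_self_nonneg (A := Aᵐᵒᵖ))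

theorem ip_sub_right (x y z : E) : ip A x (y - z) = ip A x y - ip A x z := by
  simp [ip]

theorem ip_sub_left (x y z : E) : ip A (x - y) z = ip A x z - ip A y z := by
  simp [ip]

theorem adjointableOperators_le_boundedModuleMaps :
    adjointableOperators A E ≤ boundedModuleMaps A E := by
  intro S hS x a
  refine ext_ip A fun w => star_injective ?_
  obtain ⟨w', hw'⟩ := hS w
  rw [star_ip, star_ip, hw', ip_smul_left, ip_smul_left, hw']

theorem rsmul_add (x : E) (a b : A) : x <• (a + b) = x <• a + x <• b :=
  ext_ip A fun w => by simp only [ip_smul_right, ip_add_right, mul_add]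

theorem rsmul_smul (c : ℂ) (x : E) (a : A) : x <• (c • a) = c • (x <• a) :=
  ext_ip A fun w => by simp only [ip_smul_right, ip_smul_right_complex, mul_smul_comm]

theorem rsmul_mul (x : E) (a b : A) : x <• (a * b) = (x <• a) <• b :=
  ext_ip A fun w => by simp only [ip_smul_right, mul_assoc]

theorem norm_rsmul_le (x : E) (a : A) : ‖x <• a‖ ≤ ‖a‖ * ‖x‖ := by
  refine le_of_sq_le_sq ?_ (by positivity)
  rw [norm_sq_eq_norm_ip (A := A), ip_smul_right, ip_smul_left, mul_pow,
    norm_sq_eq_norm_ip (A := A) x]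
  calc ‖star a * ip A x x * a‖ ≤ ‖star a‖ * ‖ip A x x‖ * ‖a‖ :=
        (norm_mul_le _ _).trans (by gcongr; exact norm_mul_le _ _)
    _ = ‖a‖ ^ 2 * ‖ip A x x‖ := by rw [norm_star]; ring

/-- The right action of `A` on `E` as a bounded bilinear map. -/
noncomputable def rmul : A →L[ℂ] E →L[ℂ] E :=
  LinearMap.mkContinuous₂
    (LinearMap.mk₂ ℂ (fun (a : A) (x : E) => x <• a) (fun a b x => rsmul_add x a b)
      (fun c a x => rsmul_smul c x a) (fun a x y => add_rsmul A x y a)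
      (fun c a x => smul_rsmul A c x a)) 1
    fun a x => by simpa using norm_rsmul_le x a

theorem rmul_mul_apply (a b : A) (x : E) : rmul (a * b) x = rmul b (rmul a x) :=
  rsmul_mul x a b

theorem norm_rmul_apply_le (a : A) (x : E) : ‖rmul a x‖ ≤ ‖a‖ * ‖x‖ := norm_rsmul_le x a

end RightMultiplication

/-! ### Ramps and almost disjoint slices -/

section RampSequences

variable {A : Type*} [NonUnitalCStarAlgebra A]

/-- The algebraic and metric properties of the ramps `t ↦ max 0 (min 1 (t - k))`, evaluated at a
self-adjoint element of a C⋆-algebra. -/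
structure IsRampSequence (u : ℕ → A) : Prop where
  mul_left : ∀ j k, j < k → u j * u k = u k
  mul_right : ∀ j k, j < k → u k * u j = u k
  norm_zero_le : ‖u 0‖ ≤ 1
  norm_sum_le : ∀ S : Finset ℕ, ‖∑ k ∈ S, (u k - u (k + 1))‖ ≤ 1

theorem IsRampSequence.sub_mul_sub {u : ℕ → A} (hu : IsRampSequence u) {j k : ℕ}
    (h : j + 1 < k ∨ k + 1 < j) : (u j - u (j + 1)) * (u k - u (k + 1)) = 0 := by
  rcases h with h | h
  · simp only [sub_mul, mul_sub]
    rw [hu.mul_left j k (by omega), hu.mul_left j (k + 1) (by omega),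
      hu.mul_left (j + 1) k (by omega), hu.mul_left (j + 1) (k + 1) (by omega)]
    simp
  · simp only [sub_mul, mul_sub]
    rw [hu.mul_right k j (by omega), hu.mul_right (k + 1) j (by omega),
      hu.mul_right k (j + 1) (by omega), hu.mul_right (k + 1) (j + 1) (by omega)]
    simp

/-- Distinct indices in one class mod 4 stay at least 3 apart after a shift by one, so the slices in
`IsRampSequence.sub_mul_sub` are orthogonal. -/
theorem norm_sum_le_of_residues {F : Type*} [SeminormedAddCommGroup F] (f : ℕ → F) {C : ℝ}
    (hf : ∀ S : Finset ℕ, (∀ j ∈ S, ∀ k ∈ S, j % 4 = k % 4) → ‖∑ k ∈ S, f k‖ ≤ C)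
    (S : Finset ℕ) : ‖∑ k ∈ S, f k‖ ≤ 4 * C := by
  rw [← Finset.sum_fiberwise_of_maps_to (s := S) (t := Finset.range 4) (g := fun k => k % 4)
    (fun k _ => Finset.mem_range.mpr (Nat.mod_lt _ (by norm_num)))]
  refine (norm_sum_le_of_le (Finset.range 4) fun r _ => hf _ ?_).trans (by simp)
  simp only [Finset.mem_filter]
  rintro j ⟨-, rfl⟩ k ⟨-, h⟩
  exact h.symm

end RampSequences

/-! ### Commutators of local operators with ramps -/

section LocalOperators

variable {A : Type*} [NonUnitalCStarAlgebra A] [PartialOrder A]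
  {E : Type*} [NormedAddCommGroup E] [NormedSpace ℂ E] [SMul Aᵐᵒᵖ E] [CStarModule Aᵐᵒᵖ E]

/-- An operator is local if it preserves the relations `x b = 0` and `x b = x`. -/
structure IsLocal (T : E →L[ℂ] E) : Prop where
  rmul_eq_zero : ∀ (x : E) (b : A), rmul b x = 0 → rmul b (T x) = 0
  rmul_eq_self : ∀ (x : E) (b : A), rmul b x = x → rmul b (T x) = T x

/-- With `R` for right multiplication and `d j = u j - u (j + 1)`, split `x` by the ramps `u k`, `u
(k + 1)`, `u (k + 2)`. Locality kills or fixes each piece except the interaction of `d k` with `d (k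
+ 1)`. -/
theorem IsLocal.commutator_ramp {T : E →L[ℂ] E} (hT : IsLocal (A := A) T) {u : ℕ → A}
    (hu : IsRampSequence u) (x : E) (k : ℕ) :
    T (rmul (u (k + 1)) x) - rmul (u (k + 1)) (T x) =
      rmul (u k - u (k + 1)) (T (rmul (u (k + 1) - u (k + 2)) x)) -
      rmul (u (k + 1) - u (k + 2)) (T (rmul (u k - u (k + 1)) x)) := by
  have h1 := hT.rmul_eq_self (rmul (u (k + 2)) x) (u (k + 1)) (by
    rw [← rmul_mul_apply, hu.mul_right _ _ (by omega)])
  have h2 := hT.rmul_eq_self (rmul (u (k + 1) - u (k + 2)) x) (u k) (by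
    rw [← rmul_mul_apply, sub_mul, hu.mul_right _ _ (by omega), hu.mul_right _ _ (by omega)])
  have h3 := hT.rmul_eq_zero (x - rmul (u k) x) (u (k + 1)) (by
    rw [map_sub, ← rmul_mul_apply, hu.mul_left _ _ (by omega), sub_self])
  have h4 := hT.rmul_eq_zero (rmul (u k - u (k + 1)) x) (u (k + 2)) (by
    rw [← rmul_mul_apply, sub_mul, hu.mul_left _ _ (by omega), hu.mul_left _ _ (by omega),
      sub_self, map_zero, zero_apply])
  simp only [map_sub, sub_apply] at h1 h2 h3 h4 ⊢
  grind

/-- Locality kills the cross terms, so the sum is a single product `R_w T R_v` with `v`, `w` the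
summed slices; the number of terms does not enter the bound. -/
theorem IsLocal.norm_sum_le_of_sparse {T : E →L[ℂ] E} (hT : IsLocal (A := A) T)
    {v w : ℕ → A} {S : Finset ℕ} (hv : ‖∑ k ∈ S, v k‖ ≤ 1) (hw : ‖∑ k ∈ S, w k‖ ≤ 1)
    (hvw : ∀ j ∈ S, ∀ k ∈ S, j ≠ k → v j * w k = 0) (x : E) :
    ‖∑ k ∈ S, rmul (w k) (T (rmul (v k) x))‖ ≤ ‖T‖ * ‖x‖ := by
  have h : ∑ k ∈ S, rmul (w k) (T (rmul (v k) x)) =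
      rmul (∑ k ∈ S, w k) (T (rmul (∑ k ∈ S, v k) x)) := by
    simp only [map_sum, sum_apply]
    refine Finset.sum_congr rfl fun k hk => ?_
    rw [Finset.sum_eq_single_of_mem k hk fun j hj hjk => ?_]
    refine hT.rmul_eq_zero _ _ ?_
    rw [← rmul_mul_apply, hvw k hk j hj hjk.symm, map_zero, zero_apply]
  rw [h]
  calc _ ≤ 1 * ‖T (rmul (∑ k ∈ S, v k) x)‖ := (norm_rmul_apply_le _ _).trans (by gcongr)
    _ ≤ ‖T‖ * ‖rmul (∑ k ∈ S, v k) x‖ := by rw [one_mul]; exact T.le_opNorm _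
    _ ≤ ‖T‖ * (1 * ‖x‖) := by
      gcongr
      exact (norm_rmul_apply_le _ _).trans (by gcongr)
    _ = _ := by rw [one_mul]

/-- The constant is 4 + 4 for the two sums over slices and 1 + 1 for `u 0`, which has no preceding
ramp. Only its independence of `u` and `n` matters. -/
theorem IsLocal.norm_commutator_le {T : E →L[ℂ] E} (hT : IsLocal (A := A) T) {u : ℕ → A}
    (hu : IsRampSequence u) (x : E) (n : ℕ) :
    ‖T (rmul (∑ k ∈ Finset.range (n + 1), u k) x) -
      rmul (∑ k ∈ Finset.range (n + 1), u k) (T x)‖ ≤ 10 * (‖T‖ * ‖x‖) := by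
  have hshift : ∀ S : Finset ℕ, ‖∑ k ∈ S, (u (k + 1) - u (k + 2))‖ ≤ 1 := fun S => by
    simpa using hu.norm_sum_le (S.map (addRightEmbedding 1))
  have h1 : ‖∑ k ∈ Finset.range n,
      rmul (u k - u (k + 1)) (T (rmul (u (k + 1) - u (k + 2)) x))‖ ≤ 4 * (‖T‖ * ‖x‖) := by
    refine norm_sum_le_of_residues _ (fun S hS => ?_) _
    refine hT.norm_sum_le_of_sparse (v := fun k => u (k + 1) - u (k + 2))
      (w := fun k => u k - u (k + 1)) (hshift S) (hu.norm_sum_le S) (fun j hj k hk hjk => ?_) x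
    have := hS j hj k hk
    exact hu.sub_mul_sub (by omega)
  have h2 : ‖∑ k ∈ Finset.range n,
      rmul (u (k + 1) - u (k + 2)) (T (rmul (u k - u (k + 1)) x))‖ ≤ 4 * (‖T‖ * ‖x‖) := by
    refine norm_sum_le_of_residues _ (fun S hS => ?_) _
    refine hT.norm_sum_le_of_sparse (v := fun k => u k - u (k + 1))
      (w := fun k => u (k + 1) - u (k + 2)) (hu.norm_sum_le S) (hshift S)
      (fun j hj k hk hjk => ?_) x
    have := hS j hj k hk
    exact hu.sub_mul_sub (by omega)
  have h3 : ‖T (rmul (u 0) x)‖ ≤ ‖T‖ * ‖x‖ := by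
    refine (T.le_opNorm _).trans ?_
    gcongr
    exact (norm_rmul_apply_le _ _).trans (mul_le_of_le_one_left (norm_nonneg _) hu.norm_zero_le)
  have h4 : ‖rmul (u 0) (T x)‖ ≤ ‖T‖ * ‖x‖ :=
    (norm_rmul_apply_le _ _).trans
      ((mul_le_of_le_one_left (norm_nonneg _) hu.norm_zero_le).trans (T.le_opNorm _))
  have h : T (rmul (∑ k ∈ Finset.range (n + 1), u k) x) -
      rmul (∑ k ∈ Finset.range (n + 1), u k) (T x) =
      (∑ k ∈ Finset.range n, rmul (u k - u (k + 1)) (T (rmul (u (k + 1) - u (k + 2)) x)) -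
        ∑ k ∈ Finset.range n, rmul (u (k + 1) - u (k + 2)) (T (rmul (u k - u (k + 1)) x))) +
      (T (rmul (u 0) x) - rmul (u 0) (T x)) := by
    rw [← Finset.sum_sub_distrib, ← Finset.sum_congr rfl fun k _ => hT.commutator_ramp hu x k]
    simp only [map_sum, sum_apply]
    rw [← Finset.sum_sub_distrib, Finset.sum_range_succ']
  rw [h]
  have h5 := norm_sub_le (∑ k ∈ Finset.range n,
      rmul (u k - u (k + 1)) (T (rmul (u (k + 1) - u (k + 2)) x)))
    (∑ k ∈ Finset.range n, rmul (u (k + 1) - u (k + 2)) (T (rmul (u k - u (k + 1)) x)))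
  have h6 := norm_sub_le (T (rmul (u 0) x)) (rmul (u 0) (T x))
  refine (norm_add_le _ _).trans ?_
  linarith

theorem isLocal_of_mem_alg_lat {T : E →L[ℂ] E} (hT : T ∈ alg (lat (adjointableOperators A E))) :
    IsLocal (A := A) T := by
  have h : ∀ S ∈ adjointableOperators A E, ∀ (b : A) (x : E), S (rmul b x) = rmul b (S x) :=
    fun S hS b x => adjointableOperators_le_boundedModuleMaps hS x b
  refine ⟨fun x b hx => ?_, fun x b hx => ?_⟩
  · exact hT _ (eqLocus_mem_lat (P := rmul b) (Q := 0) (fun S hS => h S hS b) (by simp)) x hx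
  · exact hT _ (eqLocus_mem_lat (P := rmul b) (Q := 1) (fun S hS => h S hS b) (by simp)) x hx

end LocalOperators

/-! ### Ramps and regularized inverses by functional calculus -/

section FunctionalCalculus

/-- The ramp that vanishes up to `k` and is equal to `1` from `k + 1` on. -/
def ramp (k : ℕ) (t : ℝ) : ℝ := max 0 (min 1 (t - k))

theorem continuous_ramp (k : ℕ) : Continuous (ramp k) := by
  unfold ramp; fun_prop

theorem ramp_zero (k : ℕ) : ramp k 0 = 0 := by
  simp [ramp]

theorem ramp_nonneg (k : ℕ) (t : ℝ) : 0 ≤ ramp k t := le_max_left _ _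

theorem ramp_le_one (k : ℕ) (t : ℝ) : ramp k t ≤ 1 := by
  simp [ramp]

theorem ramp_succ_le (k : ℕ) (t : ℝ) : ramp (k + 1) t ≤ ramp k t := by
  unfold ramp
  gcongr
  simp

theorem ramp_mul_ramp {j k : ℕ} (h : j < k) (t : ℝ) : ramp j t * ramp k t = ramp k t := by
  have hjk : (j : ℝ) + 1 ≤ k := by exact_mod_cast h
  rcases le_total t k with ht | ht
  · have : ramp k t = 0 := max_eq_left ((min_le_right _ _).trans (by linarith))
    rw [this, mul_zero]
  · have : ramp j t = 1 := by
      rw [ramp, min_eq_left (by linarith), max_eq_right zero_le_one]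
    rw [this, one_mul]

theorem sum_range_ramp {t : ℝ} (ht : 0 ≤ t) (n : ℕ) :
    ∑ k ∈ Finset.range n, ramp k t = min t n := by
  induction n with
  | zero => simp [ht]
  | succ n ih =>
    rw [Finset.sum_range_succ, ih, ramp]
    push_cast
    grind

theorem sum_ramp_sub_mem_Icc (S : Finset ℕ) (t : ℝ) :
    ∑ k ∈ S, (ramp k t - ramp (k + 1) t) ∈ Set.Icc (0 : ℝ) 1 := by
  have h0 : ∀ k, 0 ≤ ramp k t - ramp (k + 1) t := fun k => sub_nonneg.mpr (ramp_succ_le k t)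
  refine ⟨Finset.sum_nonneg fun k _ => h0 k, ?_⟩
  obtain ⟨n, hn⟩ := S.exists_nat_subset_range
  refine (Finset.sum_le_sum_of_subset_of_nonneg hn fun k _ _ => h0 k).trans ?_
  rw [Finset.sum_range_sub']
  linarith [ramp_le_one 0 t, ramp_nonneg n t]

variable {A : Type*} [NonUnitalCStarAlgebra A]

/-- If `a` is not self-adjoint, `cfcₙ` takes the value 0 and the properties are trivial. -/
theorem isRampSequence_cfcₙ (a : A) : IsRampSequence fun k => cfcₙ (ramp k) a := by
  have hc := fun k => (continuous_ramp k).continuousOn (s := quasispectrum ℝ a)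
  refine ⟨fun j k h => ?_, fun j k h => ?_, norm_cfcₙ_le fun t _ => ?_, fun S => ?_⟩
  · rw [← cfcₙ_mul _ _ a (hc j) (ramp_zero j) (hc k) (ramp_zero k)]
    simp only [ramp_mul_ramp h]
  · rw [← cfcₙ_mul _ _ a (hc k) (ramp_zero k) (hc j) (ramp_zero j)]
    simp only [mul_comm (ramp k _), ramp_mul_ramp h]
  · rw [Real.norm_of_nonneg (ramp_nonneg 0 t)]
    exact ramp_le_one 0 t
  · simp only [← cfcₙ_sub _ _ a (hc _) (ramp_zero _) (hc _) (ramp_zero _)]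
    rw [← cfcₙ_sum (fun k t => ramp k t - ramp (k + 1) t) a S
      (fun k _ => (hc k).sub (hc (k + 1))) (fun k _ => by simp [ramp_zero])]
    refine norm_cfcₙ_le fun t _ => ?_
    have := sum_ramp_sub_mem_Icc S t
    rw [Finset.sum_apply, Real.norm_of_nonneg this.1]
    exact this.2

variable [PartialOrder A] [StarOrderedRing A]

theorem exists_sum_cfcₙ_ramp_eq {a : A} (ha : 0 ≤ a) :
    ∃ n : ℕ, ∑ k ∈ Finset.range (n + 1), cfcₙ (ramp k) a = a := by
  obtain ⟨n, hn⟩ := exists_nat_ge ‖a‖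
  refine ⟨n, ?_⟩
  rw [← cfcₙ_sum ramp a _ (fun k _ => (continuous_ramp k).continuousOn) fun k _ => ramp_zero k]
  conv_rhs => rw [← cfcₙ_id' ℝ a]
  refine cfcₙ_congr fun t ht => ?_
  have ht0 : 0 ≤ t := quasispectrum_nonneg_of_nonneg a ha t ht
  have htn : t ≤ ‖a‖ := by
    have := NonUnitalIsometricContinuousFunctionalCalculus.norm_quasispectrum_le a ht
    rwa [Real.norm_of_nonneg ht0] at this
  rw [Finset.sum_apply, sum_range_ramp ht0, min_eq_left]
  push_cast
  linarith

/-- For `a = ⟨x, x⟩` the expression is the inner square of `x - x (b a)`. -/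
theorem norm_regularization_le {a : A} (ha : 0 ≤ a) {δ : ℝ} (hδ : 0 < δ) :
    ∃ b : A, IsSelfAdjoint b ∧ ‖a - a * (b * a) - a * b * a + a * b * a * (b * a)‖ ≤ δ := by
  have hden : ∀ t : ℝ, t ^ 2 + δ ^ 2 ≠ 0 := fun t => by positivity
  -- A regularized inverse of `t`, with `1 - t f(t) = δ² / (t² + δ²)`.
  set f : ℝ → ℝ := fun t => t / (t ^ 2 + δ ^ 2) with hf
  have hfc : Continuous f := by
    rw [hf]; exact continuous_id.div (by fun_prop) hden
  have hf0 : f 0 = 0 := by simp [hf]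
  refine ⟨cfcₙ f a, IsSelfAdjoint.cfcₙ, ?_⟩
  have : a - a * (cfcₙ f a * a) - a * cfcₙ f a * a + a * cfcₙ f a * a * (cfcₙ f a * a) =
      cfcₙ (fun t => t - t * (f t * t) - t * f t * t + t * f t * t * (f t * t)) a := by
    rw [cfcₙ_add .., cfcₙ_sub .., cfcₙ_sub .., cfcₙ_mul .., cfcₙ_mul .., cfcₙ_mul ..,
      cfcₙ_mul .., cfcₙ_mul .., cfcₙ_mul (fun t => t * f t) (fun t => t) a,
      cfcₙ_mul (fun t => t) f a, cfcₙ_mul f (fun t => t) a, cfcₙ_id' ℝ a]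
  rw [this]
  refine norm_cfcₙ_le fun t ht => ?_
  have ht0 : 0 ≤ t := quasispectrum_nonneg_of_nonneg a ha t ht
  have h : t - t * (f t * t) - t * f t * t + t * f t * t * (f t * t) =
      t * (δ ^ 2 / (t ^ 2 + δ ^ 2)) ^ 2 := by
    have := hden t
    simp only [hf]
    field_simp
    ring
  rw [h, Real.norm_of_nonneg (by positivity), div_pow, mul_div_assoc', div_le_iff₀ (by positivity)]
  have h1 : 0 ≤ t ^ 3 * (t * δ) := by positivity
  have h2 : 0 ≤ δ ^ 3 * (t - δ) ^ 2 := by positivity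
  have h3 : 0 ≤ δ ^ 3 * t ^ 2 := by positivity
  nlinarith

end FunctionalCalculus

/-! ### The two inclusions -/

section Main
variable {A : Type*} [NonUnitalCStarAlgebra A] [PartialOrder A] [StarOrderedRing A]
  {E : Type*} [NormedAddCommGroup E] [NormedSpace ℂ E] [SMul Aᵐᵒᵖ E] [CStarModule Aᵐᵒᵖ E]

theorem IsLocal.map_rmul_of_nonneg {T : E →L[ℂ] E} (hT : IsLocal (A := A) T) {a : A}
    (ha : 0 ≤ a) (x : E) : T (rmul a x) = rmul a (T x) := by
  have hbound : ∀ {b : A}, 0 ≤ b → ‖T (rmul b x) - rmul b (T x)‖ ≤ 10 * (‖T‖ * ‖x‖) := by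
    intro b hb
    obtain ⟨n, hn⟩ := exists_sum_cfcₙ_ramp_eq hb
    have := hT.norm_commutator_le (isRampSequence_cfcₙ b) x n
    rwa [hn] at this
  refine sub_eq_zero.mp (norm_eq_zero.mp (le_antisymm ?_ (norm_nonneg _)))
  by_contra! hpos
  -- The commutator with `n a` is `n` times that with `a`, yet obeys the same bound.
  obtain ⟨n, hn⟩ := Archimedean.arch (10 * (‖T‖ * ‖x‖) + 1) hpos
  have h := hbound (nsmul_nonneg ha n)
  rw [map_nsmul, smul_apply, smul_apply, map_nsmul, ← nsmul_sub,
    ← Nat.cast_smul_eq_nsmul ℂ, norm_smul, RCLike.norm_natCast] at h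
  rw [nsmul_eq_mul] at hn
  linarith

theorem IsLocal.map_rmul {T : E →L[ℂ] E} (hT : IsLocal (A := A) T) (a : A) (x : E) :
    T (rmul a x) = rmul a (T x) := by
  have ha : a ∈ Submodule.span ℂ {a : A | 0 ≤ a} := by
    rw [CStarAlgebra.span_nonneg]; trivial
  induction ha using Submodule.span_induction with
  | mem a ha => exact hT.map_rmul_of_nonneg ha x
  | zero => simp
  | add a b _ _ ha hb => simp [ha, hb]
  | smul c a _ ha => simp [ha]

variable (A) in
theorem exists_rsmul_ip_near (x : E) {ε : ℝ} (hε : 0 < ε) :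
    ∃ y : E, ‖x - x <• ip A y x‖ < ε := by
  obtain ⟨b, hb, h⟩ := norm_regularization_le (ip_self_nonneg (A := A) x)
    (show 0 < (ε / 2) ^ 2 by positivity)
  -- Since `b` is self-adjoint, `⟨x b, x⟩ = b ⟨x, x⟩`.
  refine ⟨x <• b, lt_of_le_of_lt (le_of_sq_le_sq ?_ (by positivity)) (half_lt_self hε)⟩
  rw [norm_sq_eq_norm_ip (A := A)]
  refine le_of_eq_of_le (congrArg _ ?_) h
  have ha : star (ip A x x) = ip A x x := star_ip x x
  simp only [ip_sub_left, ip_sub_right, ip_smul_left, ip_smul_right, star_mul, hb.star_eq, ha,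
    sub_mul, mul_assoc]
  abel

variable [CompleteSpace E]

theorem exists_rankOne_mem_adjointableOperators (y z : E) :
    ∃ S ∈ adjointableOperators A E, ∀ x, S x = y <• ip A z x := by
  let S : E →ₗ[ℂ] E :=
    { toFun := fun x => y <• ip A z x
      map_add' := fun u v => by rw [ip_add_right, rsmul_add]
      map_smul' := fun c u => by rw [ip_smul_right_complex, rsmul_smul, RingHom.id_apply] }
  have hS : IsAdjointable A S := fun w => ⟨z <• ip A y w, fun x => by
    change ip A (y <• ip A z x) w = _
    rw [ip_smul_left, star_ip, ip_smul_right]⟩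
  exact ⟨⟨S, hS.continuous⟩, hS, fun x => rfl⟩

theorem boundedModuleMaps_le_alg_lat :
    boundedModuleMaps A E ≤ alg (lat (adjointableOperators A E)) := by
  intro T hT M hM m hm
  have hclosed : IsClosed (T ⁻¹' (M : Set E)) := hM.1.preimage T.continuous
  refine hclosed.closure_subset (Metric.mem_closure_iff.mpr fun ε hε => ?_)
  obtain ⟨y, hy⟩ := exists_rsmul_ip_near A m hε
  refine ⟨m <• ip A y m, ?_, by rwa [dist_eq_norm]⟩
  obtain ⟨S, hS, hSx⟩ := exists_rankOne_mem_adjointableOperators (A := A) (T m) y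
  have := hM.2 S hS m hm
  rwa [hSx, ← hT] at this

theorem alg_lat_adjointableOperators :
    alg (lat (adjointableOperators A E)) = boundedModuleMaps A E :=
  le_antisymm (fun _ hT x a => (isLocal_of_mem_alg_lat hT).map_rmul a x)
    boundedModuleMaps_le_alg_lat

end Main

end HilbertModule

theorem theorem2p4 {A : Type*} [NonUnitalCStarAlgebra A] [PartialOrder A] [StarOrderedRing A]
    {E : Type*} [NormedAddCommGroup E] [NormedSpace ℂ E] [CompleteSpace E]
    [SMul Aᵐᵒᵖ E] [CStarModule Aᵐᵒᵖ E] :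
    alg (lat (HilbertModule.adjointableOperators A E)) = HilbertModule.boundedModuleMaps A E ∧
    IsReflexive (HilbertModule.boundedModuleMaps A E) ∧
    (IsReflexive (HilbertModule.adjointableOperators A E) ↔
      HilbertModule.adjointableOperators A E = HilbertModule.boundedModuleMaps A E) := by
  have h := HilbertModule.alg_lat_adjointableOperators (A := A) (E := E)
  refine ⟨h, h ▸ isReflexive_alg_lat _, ?_⟩
  rw [IsReflexive, reflexiveCover, h]
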